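/- **Setting.** For a measurable space $(\Omega,\mathcal F)$ and a non-empty set $\mathcal P$ of probability measures on it, let $c(A)=\sup_{P\in\mathcal P}P(A)$, $A\in\mathcal F$; an event $A$ is $\mathcal P$-polar if $c(A)=0$. Let $L^0_c$ be the space of real random variables modulo equality outside a $\mathcal P$-polar event, ordered by $X\preccurlyeq Y$ iff $\{X>Y\}$ is $\mathcal P$-polar, and let $L^0_{c+}$ be its positive cone. Write $\mu\ll\mathcal P$ if every $\mathcal P$-polar event is $\mu$-null, $ca_{c+}$ for the set of finite measures $\mu\ll\mathcal P$, and $\mathfrak P_c$ for the set of probability measures in $ca_{c+}$. For $Q\in\mathfrak P_c$ let $j_Q:L^0_c\to L^0_Q$, $[f]_c\mapsto[f]_Q$. For a set $\mathcal C\subset L^0_c$: * $\mathcal C$ is $\mathcal P$-sensitive if $\mathcal C=\bigcap_{Q\in\mathfrak P_c}j_Q^{-1}(j_Q(\mathcal C))$; * $\mathcal C$ is sequentially order closed if $X\in\mathcal C$ whenever there are $X_n\in\mathcal C$ and a decreasing sequence $(Y_n)$ in $L^0_c$ with $\inf_nY_n=0$ and $|X_n-X|\preccurlyeq Y_n$ for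 all $n$; * $\mathcal C\subset L^0_{c+}$ is solid if $X\in\mathcal C$, $Y\in L^0_{c+}$ and $Y\preccurlyeq X$ imply $Y\in\mathcal C$; * for $\mathcal C\subset L^0_{c+}$, $\mathcal C^\circ_{ca}=\{\mu\in ca_{c+}\mid \int X\,d\mu\le 1\ \ \forall X\in\mathcal C\}$ and $\mathcal C^{\circ\circ}_{ca}=\{X\in L^0_{c+}\mid\int X\,d\mu\le1\ \ \forall\mu\in\mathcal C^\circ_{ca}\}$. Let $(\Omega_1,\mathcal F_1)$, $(\Omega_2,\mathcal F_2)$ be measurable spaces, $\mathcal P_1,\mathcal P_2$ non-empty sets of probability measures on them with upper probabilities $c_1,c_2$, and let $\mathcal P$ be the set of all probability measures on $\Omega=\Omega_1\times\Omega_2$ (with the product $\sigma$-algebra) whose marginals lie in $\mathcal P_1$ and $\mathcal P_2$, with upper probability $c$. For $i=1,2$ let $\mathcal C_i\subset L^0_{c_i+}(\Omega_i)$ be non-empty, convex, solid, $\mathcal P_i$-sensitive and sequentially order closed, and let $\mathcal M_i=\mathcal C_{i,ca}^\circ\subset ca_{c_i+}(\Omega_i)$. Let $\mathcal M$ be the set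 of all $\mu\in ca_{c+}(\Omega)$ whose marginals lie in $\mathcal M_1$ and $\mathcal M_2$. Write $X_1\oplus X_2$ for the class of $(\omega_1,\omega_2)\mapsto X_1(\omega_1)+X_2(\omega_2)$ and, for $X\in L^0_{c+}(\Omega)$, put $$\Psi_X=\{(X_1,X_2)\in L^0_{c_1+}(\Omega_1)\times L^0_{c_2+}(\Omega_2)\mid X\preccurlyeq X_1\oplus X_2\},$$ $$\mathcal D=\Big\{Y\in L^0_{c+}(\Omega)\ \Big|\ \sup_{\mu\in\mathcal M}\int Y\,d\mu\le1\Big\},$$ $$\mathcal C=\Big\{Y\in L^0_{c+}(\Omega)\ \Big|\ \exists (Y_1,Y_2)\in\Psi_Y:\ \sup_{\mu_1\in\mathcal M_1}\int Y_1\,d\mu_1+\sup_{\mu_2\in\mathcal M_2}\int Y_2\,d\mu_2\le1\Big\}.$$ **Theorem.** $\mathcal C^{\circ\circ}_{ca}=\mathcal D^{\circ\circ}_{ca}=\mathcal D$. Moreover, $\mathcal C=\mathcal D$ if and only if $\mathcal C$ is $\mathcal P$-sensitive and sequentially order closed. If $\mathcal C=\mathcal D$, then for every $X\in L^0_{c+}(\Omega)$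 with $0<\sup_{\mu\in\mathcal M}\int X\,d\mu<\infty$ there is no duality gap and the dual problem has a solution: $$\min_{(X_1,X_2)\in\Psi_X}\Big(\sup_{\mu_1\in\mathcal M_1}\int X_1\,d\mu_1+\sup_{\mu_2\in\mathcal M_2}\int X_2\,d\mu_2\Big)=\sup_{\mu\in\mathcal M}\int X\,d\mu .$$ -/

import Mathlib

open MeasureTheory

noncomputable section

namespace RobustTransport

section Basics

variable {Ω : Type*} [MeasurableSpace Ω]

/-- The upper probability `c(A) = sup_{P ∈ 𝔓} P(A)` induced by a set `𝔓` of probability measures. -/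
def upperProb (𝔓 : Set (Measure Ω)) (A : Set Ω) : ENNReal :=
  ⨆ P ∈ 𝔓, P A

/-- `μ ≪ 𝔓`: every `𝔓`-polar event is a `μ`-null event. -/
def DominatedBy (μ : Measure Ω) (𝔓 : Set (Measure Ω)) : Prop :=
  ∀ N : Set Ω, MeasurableSet N → upperProb 𝔓 N = 0 → μ N = 0

/-- The set `ca_{c+}` of finite measures dominated by `𝔓`. -/
def caPos (𝔓 : Set (Measure Ω)) : Set (Measure Ω) :=
  {μ | IsFiniteMeasure μ ∧ DominatedBy μ 𝔓}

/-- The set `𝔓_c(Ω)` of probability measures dominated by `𝔓`. -/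
def probDominated (𝔓 : Set (Measure Ω)) : Set (Measure Ω) :=
  {Q | IsProbabilityMeasure Q ∧ DominatedBy Q 𝔓}

/-- A (generally not σ-finite) measure whose null events are exactly the `𝔓`-polar events
(see `polarMeasure_eq_zero_iff`). It only serves to express "`𝔓`-quasi surely" as
"almost everywhere". -/
def polarMeasure (𝔓 : Set (Measure Ω)) : Measure Ω :=
  Measure.sum fun P : 𝔓 => (P : Measure Ω)

theorem polarMeasure_eq_zero_iff (𝔓 : Set (Measure Ω)) {A : Set Ω} (hA : MeasurableSet A) :
    polarMeasure 𝔓 A = 0 ↔ upperProb 𝔓 A = 0 := by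
  simp [polarMeasure, upperProb, Measure.sum_apply_eq_zero' hA]

theorem dominatedBy_iff (μ : Measure Ω) (𝔓 : Set (Measure Ω)) :
    DominatedBy μ 𝔓 ↔ μ ≪ polarMeasure 𝔓 := by
  constructor
  · intro h
    refine Measure.AbsolutelyContinuous.mk fun s hs h0 => ?_
    exact h s hs ((polarMeasure_eq_zero_iff 𝔓 hs).1 h0)
  · intro h N hN h0
    exact h ((polarMeasure_eq_zero_iff 𝔓 hN).2 h0)

/-- The space `L⁰_c` of real random variables modulo `𝔓`-quasi-sure equality. Its order
(from Mathlib's `AEEqFun`) is the `𝔓`-quasi-sure order, see `L0.le_iff` and `L0.eq_iff`. -/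
abbrev L0 (𝔓 : Set (Measure Ω)) : Type _ :=
  Ω →ₘ[polarMeasure 𝔓] ℝ

theorem L0.le_iff {𝔓 : Set (Measure Ω)} (X Y : L0 𝔓) :
    X ≤ Y ↔ upperProb 𝔓 {ω | Y ω < X ω} = 0 := by
  rw [← AEEqFun.coeFn_le, ← polarMeasure_eq_zero_iff 𝔓
    (measurableSet_lt Y.measurable X.measurable)]
  simp [Filter.EventuallyLE, ae_iff]

theorem L0.eq_iff {𝔓 : Set (Measure Ω)} (X Y : L0 𝔓) :
    X = Y ↔ upperProb 𝔓 {ω | X ω ≠ Y ω} = 0 := by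
  have hm : MeasurableSet {ω | X ω ≠ Y ω} :=
    (measurableSet_eq_fun X.measurable Y.measurable).compl
  rw [← polarMeasure_eq_zero_iff 𝔓 hm]
  exact AEEqFun.ext_iff

/-- The integral `∫ X dμ ∈ [0, ∞]` of `X ∈ L⁰_{c+}` with respect to `μ ∈ ca_{c+}`. -/
def lintegralClass {𝔓 : Set (Measure Ω)} (X : L0 𝔓) (μ : Measure Ω) : ENNReal :=
  ∫⁻ ω, ENNReal.ofReal (X ω) ∂μ

/-- The integral against a dominated measure can be computed with any representative. -/
theorem lintegralClass_congr {𝔓 : Set (Measure Ω)} (X : L0 𝔓) {μ : Measure Ω}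
    (hμ : DominatedBy μ 𝔓) {f : Ω → ℝ} (hf : X =ᵐ[polarMeasure 𝔓] f) :
    lintegralClass X μ = ∫⁻ ω, ENNReal.ofReal (f ω) ∂μ := by
  refine lintegral_congr_ae ?_
  filter_upwards [((dominatedBy_iff μ 𝔓).1 hμ).ae_le hf] with ω hω
  rw [hω]

theorem DominatedBy.quasiMeasurePreserving_id {Q : Measure Ω} {𝔓 : Set (Measure Ω)}
    (h : DominatedBy Q 𝔓) : Measure.QuasiMeasurePreserving id Q (polarMeasure 𝔓) :=
  ⟨measurable_id, by rw [Measure.map_id]; exact (dominatedBy_iff Q 𝔓).1 h⟩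

/-- The map `j_Q : L⁰_c → L⁰_Q`, `[f]_c ↦ [f]_Q`, for `Q ∈ 𝔓_c(Ω)`. -/
def jMap (𝔓 : Set (Measure Ω)) (Q : probDominated 𝔓) (X : L0 𝔓) : Ω →ₘ[(Q : Measure Ω)] ℝ :=
  X.compQuasiMeasurePreserving id Q.2.2.quasiMeasurePreserving_id

/-- `𝔓`-sensitivity: `C = ⋂_{Q ∈ 𝔓_c(Ω)} j_Q⁻¹(j_Q(C))`. -/
def IsSensitive (𝔓 : Set (Measure Ω)) (C : Set (L0 𝔓)) : Prop :=
  C = ⋂ Q : probDominated 𝔓, jMap 𝔓 Q ⁻¹' (jMap 𝔓 Q '' C)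

/-- Solidity of a set in the positive cone `L⁰_{c+}`. -/
def IsSolidPos {𝔓 : Set (Measure Ω)} (C : Set (L0 𝔓)) : Prop :=
  (∀ X ∈ C, 0 ≤ X) ∧ ∀ X ∈ C, ∀ Y : L0 𝔓, 0 ≤ Y → Y ≤ X → Y ∈ C

/-- Order convergence of a sequence in `L⁰_c`. -/
def OrderTendsto {𝔓 : Set (Measure Ω)} (X : ℕ → L0 𝔓) (X' : L0 𝔓) : Prop :=
  ∃ Y : ℕ → L0 𝔓, Antitone Y ∧ IsGLB (Set.range Y) 0 ∧ ∀ n, |X n - X'| ≤ Y n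

/-- Sequential order closedness of a subset of `L⁰_c`. -/
def IsSeqOrderClosed {𝔓 : Set (Measure Ω)} (C : Set (L0 𝔓)) : Prop :=
  ∀ (X : ℕ → L0 𝔓) (X' : L0 𝔓), (∀ n, X n ∈ C) → OrderTendsto X X' → X' ∈ C

/-- The polar `C°_{ca}`. -/
def caPolar (𝔓 : Set (Measure Ω)) (C : Set (L0 𝔓)) : Set (Measure Ω) :=
  {μ | μ ∈ caPos 𝔓 ∧ ∀ X ∈ C, lintegralClass X μ ≤ 1}

/-- The bipolar `C°°_{ca}`. -/
def caBipolar (𝔓 : Set (Measure Ω)) (C : Set (L0 𝔓)) : Set (L0 𝔓) :=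
  {X | 0 ≤ X ∧ ∀ μ ∈ caPolar 𝔓 C, lintegralClass X μ ≤ 1}

/-- The support functional `X ↦ sup_{μ ∈ ℳ} ∫ X dμ ∈ [0, ∞]`. -/
def supIntegral {𝔓 : Set (Measure Ω)} (ℳ : Set (Measure Ω)) (X : L0 𝔓) : ENNReal :=
  ⨆ μ ∈ ℳ, lintegralClass X μ

end Basics

section Transport

variable {Ω₁ Ω₂ : Type*} [MeasurableSpace Ω₁] [MeasurableSpace Ω₂]

/-- All probability measures on the product space with marginals in `𝔓₁` and `𝔓₂`. -/
def couplings (𝔓₁ : Set (Measure Ω₁)) (𝔓₂ : Set (Measure Ω₂)) : Set (Measure (Ω₁ × Ω₂)) :=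
  {P | IsProbabilityMeasure P ∧ P.fst ∈ 𝔓₁ ∧ P.snd ∈ 𝔓₂}

theorem quasiMeasurePreserving_fst (𝔓₁ : Set (Measure Ω₁)) (𝔓₂ : Set (Measure Ω₂)) :
    Measure.QuasiMeasurePreserving (Prod.fst : Ω₁ × Ω₂ → Ω₁)
      (polarMeasure (couplings 𝔓₁ 𝔓₂)) (polarMeasure 𝔓₁) := by
  refine ⟨measurable_fst, Measure.AbsolutelyContinuous.mk fun s hs h0 => ?_⟩
  rw [Measure.map_apply measurable_fst hs, polarMeasure,
    Measure.sum_apply_eq_zero' (measurable_fst hs)]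
  rw [polarMeasure, Measure.sum_apply_eq_zero' hs] at h0
  intro P
  have h := h0 ⟨_, P.2.2.1⟩
  rwa [Measure.fst_apply hs] at h

theorem quasiMeasurePreserving_snd (𝔓₁ : Set (Measure Ω₁)) (𝔓₂ : Set (Measure Ω₂)) :
    Measure.QuasiMeasurePreserving (Prod.snd : Ω₁ × Ω₂ → Ω₂)
      (polarMeasure (couplings 𝔓₁ 𝔓₂)) (polarMeasure 𝔓₂) := by
  refine ⟨measurable_snd, Measure.AbsolutelyContinuous.mk fun s hs h0 => ?_⟩
  rw [Measure.map_apply measurable_snd hs, polarMeasure,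
    Measure.sum_apply_eq_zero' (measurable_snd hs)]
  rw [polarMeasure, Measure.sum_apply_eq_zero' hs] at h0
  intro P
  have h := h0 ⟨_, P.2.2.2⟩
  rwa [Measure.snd_apply hs] at h

/-- `X₁ ⊕ X₂`, the class of `(ω₁, ω₂) ↦ f₁(ω₁) + f₂(ω₂)` for `f₁ ∈ X₁`, `f₂ ∈ X₂`. -/
def oplus {𝔓₁ : Set (Measure Ω₁)} {𝔓₂ : Set (Measure Ω₂)} (X₁ : L0 𝔓₁) (X₂ : L0 𝔓₂) :
    L0 (couplings 𝔓₁ 𝔓₂) :=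
  X₁.compQuasiMeasurePreserving Prod.fst (quasiMeasurePreserving_fst 𝔓₁ 𝔓₂) +
    X₂.compQuasiMeasurePreserving Prod.snd (quasiMeasurePreserving_snd 𝔓₁ 𝔓₂)

theorem oplus_ae {𝔓₁ : Set (Measure Ω₁)} {𝔓₂ : Set (Measure Ω₂)} (X₁ : L0 𝔓₁) (X₂ : L0 𝔓₂) :
    oplus X₁ X₂ =ᵐ[polarMeasure (couplings 𝔓₁ 𝔓₂)] fun ω => X₁ ω.1 + X₂ ω.2 := by
  have h₁ := X₁.coeFn_compQuasiMeasurePreserving (quasiMeasurePreserving_fst 𝔓₁ 𝔓₂)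
  have h₂ := X₂.coeFn_compQuasiMeasurePreserving (quasiMeasurePreserving_snd 𝔓₁ 𝔓₂)
  refine (AEEqFun.coeFn_add _ _).trans ?_
  filter_upwards [h₁, h₂] with ω e₁ e₂
  simp [e₁, e₂]

/-- The feasible set `ℳ` of the primal problem: all `μ ∈ ca_{c+}(Ω₁ × Ω₂)` with marginals in
`ℳ₁` and `ℳ₂`. -/
def primalMeasures (𝔓₁ : Set (Measure Ω₁)) (𝔓₂ : Set (Measure Ω₂))
    (ℳ₁ : Set (Measure Ω₁)) (ℳ₂ : Set (Measure Ω₂)) : Set (Measure (Ω₁ × Ω₂)) :=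
  {μ | μ ∈ caPos (couplings 𝔓₁ 𝔓₂) ∧ μ.fst ∈ ℳ₁ ∧ μ.snd ∈ ℳ₂}

/-- The feasible set `Ψ_X` of the dual problem. -/
def dualPairs {𝔓₁ : Set (Measure Ω₁)} {𝔓₂ : Set (Measure Ω₂)} (X : L0 (couplings 𝔓₁ 𝔓₂)) :
    Set (L0 𝔓₁ × L0 𝔓₂) :=
  {p | 0 ≤ p.1 ∧ 0 ≤ p.2 ∧ X ≤ oplus p.1 p.2}

/-- The objective of the dual problem. -/
def dualValue {𝔓₁ : Set (Measure Ω₁)} {𝔓₂ : Set (Measure Ω₂)}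
    (ℳ₁ : Set (Measure Ω₁)) (ℳ₂ : Set (Measure Ω₂)) (p : L0 𝔓₁ × L0 𝔓₂) : ENNReal :=
  supIntegral ℳ₁ p.1 + supIntegral ℳ₂ p.2

/-- The set `𝒞` of claims superreplicable by marginal payoffs at cost at most one. -/
def claimsC (𝔓₁ : Set (Measure Ω₁)) (𝔓₂ : Set (Measure Ω₂))
    (ℳ₁ : Set (Measure Ω₁)) (ℳ₂ : Set (Measure Ω₂)) : Set (L0 (couplings 𝔓₁ 𝔓₂)) :=
  {Y | 0 ≤ Y ∧ ∃ p ∈ dualPairs Y, dualValue ℳ₁ ℳ₂ p ≤ 1}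

/-- The set `𝒟` of claims whose primal value is at most one. -/
def claimsD (𝔓₁ : Set (Measure Ω₁)) (𝔓₂ : Set (Measure Ω₂))
    (ℳ₁ : Set (Measure Ω₁)) (ℳ₂ : Set (Measure Ω₂)) : Set (L0 (couplings 𝔓₁ 𝔓₂)) :=
  {Y | 0 ≤ Y ∧ supIntegral (primalMeasures 𝔓₁ 𝔓₂ ℳ₁ ℳ₂) Y ≤ 1}

end Transport

end RobustTransport

end

open RobustTransport

namespace RobustTransport

open Filter Topology

/-! ### Quasi-sure calculus, sensitivity and order convergence. -/

section General

variable {Ω : Type*} [MeasurableSpace Ω] {𝔓 : Set (Measure Ω)}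

/-! The first two identities come from comparing polars. Weak duality (`supIntegral_le_dualValue`)
gives 𝒞 ⊆ 𝒟, hence 𝒟° ⊆ 𝒞°, and ℳ ⊆ 𝒟° by definition of 𝒟. Conversely, payoffs X ⊕ 0 and 0 ⊕ X with
X in Cᵢ cost at most one, so testing a measure of 𝒞° on them puts its marginals into ℳ₁ and ℳ₂
(`caPolar_claimsC_subset`). Thus 𝒞° = ℳ = 𝒟°, and 𝒟, being the polar of ℳ, is its own bipolar.

A polar of finite dominated measures is always sensitive (normalise each measure) and sequentially
order closed (Fatou), so 𝒞 = 𝒟 forces both properties on 𝒞. For the converse, 𝒞 is convex, solid and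
contains 0, so the bipolar theorem `caBipolar_subset` yields 𝒟 = 𝒞°° ⊆ 𝒞. In that theorem
sensitivity reduces membership to a single Q. Under Q, truncation leads into L²(Q), where
Hahn–Banach and Riesz give a separating density; solidity allows passing to its positive part, which
defines a measure in the polar.

Attainment is homogeneity: X divided by its primal value lies in 𝒟 = 𝒞, and the pair witnessing
this, scaled back, is optimal. -/

theorem DominatedBy.ae_of_polar {μ : Measure Ω} (hμ : DominatedBy μ 𝔓) {p : Ω → Prop}
    (h : ∀ᵐ ω ∂polarMeasure 𝔓, p ω) : ∀ᵐ ω ∂μ, p ω :=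
  ((dominatedBy_iff μ 𝔓).1 hμ).ae_le h

theorem ae_polarMeasure_iff {p : Ω → Prop} (hp : MeasurableSet {ω | p ω}) :
    (∀ᵐ ω ∂polarMeasure 𝔓, p ω) ↔ ∀ P ∈ 𝔓, ∀ᵐ ω ∂P, p ω := by
  simp only [ae_iff]
  have hm : MeasurableSet {ω | ¬ p ω} := hp.compl
  rw [polarMeasure_eq_zero_iff 𝔓 hm]
  simp [upperProb]

theorem mem_probDominated_of_mem {P : Measure Ω} (hP : P ∈ 𝔓) [IsProbabilityMeasure P] :
    P ∈ probDominated 𝔓 :=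
  ⟨inferInstance, fun _ _ h0 => by
    simp only [upperProb, ENNReal.iSup_eq_zero] at h0; exact h0 P hP⟩

theorem jMap_eq_iff (Q : probDominated 𝔓) (X Y : L0 𝔓) :
    jMap 𝔓 Q X = jMap 𝔓 Q Y ↔ X =ᵐ[(Q : Measure Ω)] Y := by
  have hX := X.coeFn_compQuasiMeasurePreserving Q.2.2.quasiMeasurePreserving_id
  have hY := Y.coeFn_compQuasiMeasurePreserving Q.2.2.quasiMeasurePreserving_id
  rw [AEEqFun.ext_iff]
  constructor
  · exact fun h => hX.symm.trans (h.trans hY)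
  · exact fun h => hX.trans (EventuallyEq.trans h hY.symm)

/-- A set is sensitive iff membership can be tested under each dominated probability measure. -/
theorem isSensitive_iff (C : Set (L0 𝔓)) :
    IsSensitive 𝔓 C ↔
      ∀ X : L0 𝔓, (∀ Q ∈ probDominated 𝔓, ∃ Y ∈ C, Y =ᵐ[Q] X) → X ∈ C := by
  unfold IsSensitive
  constructor
  · intro h X hX
    rw [h]
    refine Set.mem_iInter.2 fun Q => ?_
    obtain ⟨Y, hY, e⟩ := hX Q Q.2
    exact ⟨Y, hY, (jMap_eq_iff Q Y X).2 e⟩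
  · intro h
    refine Set.Subset.antisymm (fun X hX => Set.mem_iInter.2 fun Q => ⟨X, hX, rfl⟩) fun X hX => ?_
    refine h X fun Q hQ => ?_
    obtain ⟨Y, hY, e⟩ := Set.mem_iInter.1 hX ⟨Q, hQ⟩
    exact ⟨Y, hY, (jMap_eq_iff ⟨Q, hQ⟩ Y X).1 e⟩

/-- The class in `L⁰_c` of a measurable function. -/
noncomputable def L0.ofMeasurable (𝔓 : Set (Measure Ω)) (f : Ω → ℝ) (hf : Measurable f) : L0 𝔓 :=
  AEEqFun.mk f hf.aestronglyMeasurable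

theorem L0.coeFn_ofMeasurable (f : Ω → ℝ) (hf : Measurable f) :
    L0.ofMeasurable 𝔓 f hf =ᵐ[polarMeasure 𝔓] f :=
  AEEqFun.coeFn_mk _ _

theorem L0.nonneg_iff (X : L0 𝔓) : 0 ≤ X ↔ ∀ᵐ ω ∂polarMeasure 𝔓, 0 ≤ X ω := by
  rw [← AEEqFun.coeFn_le]
  constructor
  · intro h; filter_upwards [h, AEEqFun.coeFn_zero (μ := polarMeasure 𝔓) (β := ℝ)] with ω h e
    simpa [e] using h
  · intro h; filter_upwards [h, AEEqFun.coeFn_zero (μ := polarMeasure 𝔓) (β := ℝ)] with ω h e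
    simpa [e] using h

theorem IsSolidPos.ofMeasurable_mem {C : Set (L0 𝔓)} (hC : IsSolidPos C) {Y : L0 𝔓} (hY : Y ∈ C)
    {f : Ω → ℝ} (hf : Measurable f) (h : ∀ᵐ ω ∂polarMeasure 𝔓, 0 ≤ f ω ∧ f ω ≤ Y ω) :
    L0.ofMeasurable 𝔓 f hf ∈ C := by
  refine hC.2 Y hY _ ((L0.nonneg_iff _).2 ?_) (AEEqFun.coeFn_le.1 ?_)
  · filter_upwards [h, L0.coeFn_ofMeasurable (𝔓 := 𝔓) f hf] with ω h e
    rw [e]; exact h.1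
  · filter_upwards [h, L0.coeFn_ofMeasurable (𝔓 := 𝔓) f hf] with ω h e
    rw [e]; exact h.2

theorem IsSolidPos.zero_mem {C : Set (L0 𝔓)} (hC : IsSolidPos C) (hne : C.Nonempty) :
    (0 : L0 𝔓) ∈ C := by
  obtain ⟨X, hX⟩ := hne
  exact hC.2 X hX 0 le_rfl (hC.1 X hX)

/-- The pointwise infimum of the countably many dominating Yₙ is measurable, and its class is a
lower bound of them in L⁰. So the lattice infimum being 0 makes the pointwise one vanish quasi
surely, and Yₙ squeezes the error. -/
theorem OrderTendsto.ae_tendsto {X : ℕ → L0 𝔓} {X' : L0 𝔓} (h : OrderTendsto X X') :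
    ∀ᵐ ω ∂polarMeasure 𝔓, Tendsto (fun n => X n ω) atTop (𝓝 (X' ω)) := by
  obtain ⟨Y, hanti, hglb, hle⟩ := h
  have hpos : ∀ᵐ ω ∂polarMeasure 𝔓, ∀ n, 0 ≤ Y n ω :=
    ae_all_iff.2 fun n => (L0.nonneg_iff _).1 (hglb.1 ⟨n, rfl⟩)
  have hmono : ∀ᵐ ω ∂polarMeasure 𝔓, ∀ n, Y (n + 1) ω ≤ Y n ω :=
    ae_all_iff.2 fun n => AEEqFun.coeFn_le.2 (hanti n.le_succ)
  have habs : ∀ᵐ ω ∂polarMeasure 𝔓, ∀ n, |X n ω - X' ω| ≤ Y n ω := by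
    refine ae_all_iff.2 fun n => ?_
    filter_upwards [AEEqFun.coeFn_le.2 (hle n), AEEqFun.coeFn_abs (X n - X'),
      AEEqFun.coeFn_sub (X n) X'] with ω h1 h2 h3
    rw [h2, h3] at h1
    exact h1
  have hfm : Measurable fun ω => ⨅ n, Y n ω := Measurable.iInf fun n => (Y n).measurable
  have hlow : L0.ofMeasurable 𝔓 _ hfm ≤ 0 := by
    refine hglb.2 ?_
    rintro _ ⟨n, rfl⟩
    refine AEEqFun.coeFn_le.1 ?_
    filter_upwards [hpos, L0.coeFn_ofMeasurable (𝔓 := 𝔓) _ hfm] with ω h e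
    rw [e]
    exact ciInf_le ⟨0, by rintro _ ⟨k, rfl⟩; exact h k⟩ n
  filter_upwards [hpos, hmono, habs, AEEqFun.coeFn_le.2 hlow,
    L0.coeFn_ofMeasurable (𝔓 := 𝔓) _ hfm,
    AEEqFun.coeFn_zero (μ := polarMeasure 𝔓) (β := ℝ)] with ω h0 hm ha hl e e0
  rw [e, e0] at hl
  have hi : ⨅ n, Y n ω = 0 := le_antisymm hl (le_ciInf h0)
  have ht : Tendsto (fun n => Y n ω) atTop (𝓝 0) := by
    rw [← hi]
    exact tendsto_atTop_ciInf (antitone_nat_of_succ_le hm)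
      ⟨0, by rintro _ ⟨k, rfl⟩; exact h0 k⟩
  rw [tendsto_iff_norm_sub_tendsto_zero]
  exact squeeze_zero (fun _ => norm_nonneg _) ha ht

/-- For increasing sequences the error g - fₙ is itself a decreasing dominating sequence, so
quasi-sure convergence suffices. Without monotonicity a single real-valued dominating sequence would
have to be found. -/
theorem orderTendsto_ofMeasurable_of_monotone {f : ℕ → Ω → ℝ} {g : Ω → ℝ}
    (hf : ∀ n, Measurable (f n)) (hg : Measurable g)
    (hmono : ∀ᵐ ω ∂polarMeasure 𝔓, Monotone fun n => f n ω)
    (hlim : ∀ᵐ ω ∂polarMeasure 𝔓, Tendsto (fun n => f n ω) atTop (𝓝 (g ω))) :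
    OrderTendsto (fun n => L0.ofMeasurable 𝔓 (f n) (hf n)) (L0.ofMeasurable 𝔓 g hg) := by
  have hsub : ∀ n, Measurable fun ω => g ω - f n ω := fun n => hg.sub (hf n)
  refine ⟨fun n => L0.ofMeasurable 𝔓 (fun ω => g ω - f n ω) (hsub n), ?_, ⟨?_, ?_⟩, ?_⟩
  · intro m n hmn
    refine AEEqFun.coeFn_le.1 ?_
    filter_upwards [hmono, L0.coeFn_ofMeasurable (𝔓 := 𝔓) _ (hsub n),
      L0.coeFn_ofMeasurable (𝔓 := 𝔓) _ (hsub m)] with ω hm e1 e2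
    have := hm hmn
    simp only at this
    rw [e1, e2]
    linarith
  · rintro _ ⟨n, rfl⟩
    refine (L0.nonneg_iff _).2 ?_
    filter_upwards [hmono, hlim, L0.coeFn_ofMeasurable (𝔓 := 𝔓) _ (hsub n)] with ω hm hl e
    rw [e]
    have := hm.ge_of_tendsto hl n
    linarith
  · intro Z hZ
    refine AEEqFun.coeFn_le.1 ?_
    have hall : ∀ᵐ ω ∂polarMeasure 𝔓, ∀ n, Z ω ≤ g ω - f n ω := by
      refine ae_all_iff.2 fun n => ?_
      filter_upwards [AEEqFun.coeFn_le.2 (hZ ⟨n, rfl⟩),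
        L0.coeFn_ofMeasurable (𝔓 := 𝔓) _ (hsub n)] with ω h e
      rw [e] at h
      exact h
    filter_upwards [hall, hlim, AEEqFun.coeFn_zero (μ := polarMeasure 𝔓) (β := ℝ)] with ω h hl e0
    rw [e0]
    have := (tendsto_const_nhds (x := g ω)).sub hl
    rw [sub_self] at this
    exact ge_of_tendsto' this h
  · intro n
    refine AEEqFun.coeFn_le.1 ?_
    filter_upwards [hmono, hlim, AEEqFun.coeFn_abs
        (L0.ofMeasurable 𝔓 (f n) (hf n) - L0.ofMeasurable 𝔓 g hg),
      AEEqFun.coeFn_sub (L0.ofMeasurable 𝔓 (f n) (hf n)) (L0.ofMeasurable 𝔓 g hg),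
      L0.coeFn_ofMeasurable (𝔓 := 𝔓) _ (hf n), L0.coeFn_ofMeasurable (𝔓 := 𝔓) _ hg,
      L0.coeFn_ofMeasurable (𝔓 := 𝔓) _ (hsub n)] with ω hm hl e1 e2 e3 e4 e5
    have := hm.ge_of_tendsto hl n
    rw [e1, e2, Pi.sub_apply, e3, e4, e5, abs_sub_comm, abs_of_nonneg (by linarith)]

theorem lintegralClass_mono {X Y : L0 𝔓} {μ : Measure Ω} (hμ : DominatedBy μ 𝔓) (h : X ≤ Y) :
    lintegralClass X μ ≤ lintegralClass Y μ := by
  refine lintegral_mono_ae ?_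
  filter_upwards [hμ.ae_of_polar (AEEqFun.coeFn_le.2 h)] with ω hω
  exact ENNReal.ofReal_le_ofReal hω

theorem lintegralClass_le_supIntegral {ℳ : Set (Measure Ω)} {μ : Measure Ω} (hμ : μ ∈ ℳ)
    (X : L0 𝔓) : lintegralClass X μ ≤ supIntegral ℳ X :=
  le_iSup₂ (f := fun μ (_ : μ ∈ ℳ) => lintegralClass X μ) μ hμ

theorem supIntegral_zero {ℳ : Set (Measure Ω)} (hℳ : ℳ ⊆ caPos 𝔓) :
    supIntegral ℳ (0 : L0 𝔓) = 0 := by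
  simp only [supIntegral, ENNReal.iSup_eq_zero]
  intro μ hμ
  rw [lintegralClass_congr 0 (hℳ hμ).2 AEEqFun.coeFn_zero]
  simp

theorem supIntegral_add_le {ℳ : Set (Measure Ω)} (hℳ : ℳ ⊆ caPos 𝔓) (X Y : L0 𝔓) :
    supIntegral ℳ (X + Y) ≤ supIntegral ℳ X + supIntegral ℳ Y := by
  refine iSup₂_le fun μ hμ => ?_
  refine le_trans ?_ (add_le_add (lintegralClass_le_supIntegral hμ X)
    (lintegralClass_le_supIntegral hμ Y))
  rw [lintegralClass_congr _ (hℳ hμ).2 (AEEqFun.coeFn_add X Y), lintegralClass, lintegralClass,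
    ← lintegral_add_left X.measurable.ennreal_ofReal]
  exact lintegral_mono fun ω => ENNReal.ofReal_add_le

theorem lintegralClass_smul {μ : Measure Ω} (hμ : DominatedBy μ 𝔓) {a : ℝ} (ha : 0 ≤ a)
    (X : L0 𝔓) : lintegralClass (a • X) μ = ENNReal.ofReal a * lintegralClass X μ := by
  rw [lintegralClass_congr _ hμ (AEEqFun.coeFn_smul a X), lintegralClass,
    ← lintegral_const_mul _ X.measurable.ennreal_ofReal]
  simp [ENNReal.ofReal_mul ha]

theorem supIntegral_smul {ℳ : Set (Measure Ω)} (hℳ : ℳ ⊆ caPos 𝔓) {a : ℝ} (ha : 0 ≤ a)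
    (X : L0 𝔓) : supIntegral ℳ (a • X) = ENNReal.ofReal a * supIntegral ℳ X := by
  simp only [supIntegral, ENNReal.mul_iSup]
  exact iSup_congr fun μ => iSup_congr fun hμ => lintegralClass_smul (hℳ hμ).2 ha X

theorem L0.smul_nonneg {a : ℝ} (ha : 0 ≤ a) {X : L0 𝔓} (hX : 0 ≤ X) : 0 ≤ a • X := by
  rw [L0.nonneg_iff] at *
  filter_upwards [hX, AEEqFun.coeFn_smul a X] with ω h e
  rw [e]; exact mul_nonneg ha h

theorem L0.add_le_add {X Y X' Y' : L0 𝔓} (h : X ≤ Y) (h' : X' ≤ Y') : X + X' ≤ Y + Y' := by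
  rw [← AEEqFun.coeFn_le] at *
  filter_upwards [h, h', AEEqFun.coeFn_add X X', AEEqFun.coeFn_add Y Y'] with ω h1 h2 e1 e2
  rw [e1, e2]; exact _root_.add_le_add h1 h2

theorem L0.smul_le_smul {a : ℝ} (ha : 0 ≤ a) {X Y : L0 𝔓} (h : X ≤ Y) : a • X ≤ a • Y := by
  rw [← AEEqFun.coeFn_le] at *
  filter_upwards [h, AEEqFun.coeFn_smul a X, AEEqFun.coeFn_smul a Y] with ω h1 e1 e2
  rw [e1, e2]; exact mul_le_mul_of_nonneg_left h1 ha

/-- The polar in `L⁰_{c+}` of a set of finite measures is sensitive. -/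
theorem isSensitive_setOf_supIntegral_le (hprob : ∀ P ∈ 𝔓, IsProbabilityMeasure P)
    {ℳ : Set (Measure Ω)} (hℳ : ℳ ⊆ caPos 𝔓) :
    IsSensitive 𝔓 {Y : L0 𝔓 | 0 ≤ Y ∧ supIntegral ℳ Y ≤ 1} := by
  refine (isSensitive_iff _).2 fun X hX => ⟨?_, iSup₂_le fun μ hμ => ?_⟩
  · refine (L0.nonneg_iff X).2 ((ae_polarMeasure_iff (X.measurable measurableSet_Ici)).2 ?_)
    intro P hP
    have := hprob P hP
    have hPd := mem_probDominated_of_mem hP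
    obtain ⟨Y, hY, e⟩ := hX P hPd
    filter_upwards [e, hPd.2.ae_of_polar ((L0.nonneg_iff Y).1 hY.1)] with ω h1 h2
    rw [← h1]; exact h2
  · have := (hℳ hμ).1
    rcases eq_or_ne μ 0 with rfl | h0
    · simp [lintegralClass]
    have : NeZero μ := ⟨h0⟩
    -- Sensitivity tests only probability measures; normalising μ ≠ 0 keeps its null sets, hence the
    -- integral of X.
    have hac : μ ≪ (μ Set.univ)⁻¹ • μ :=
      Measure.absolutelyContinuous_smul (ENNReal.inv_ne_zero.2 (measure_ne_top μ _))
    obtain ⟨Y, hY, e⟩ := hX ((μ Set.univ)⁻¹ • μ) ⟨isProbabilityMeasureSMul, fun N hN hN0 => by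
      simp [(hℳ hμ).2 N hN hN0]⟩
    have : lintegralClass X μ = lintegralClass Y μ :=
      lintegral_congr_ae (by filter_upwards [hac.ae_le e] with ω h; rw [h])
    rw [this]
    exact (lintegralClass_le_supIntegral hμ Y).trans hY.2

/-- The polar in `L⁰_{c+}` of a set of finite measures is sequentially order closed. -/
theorem isSeqOrderClosed_setOf_supIntegral_le {ℳ : Set (Measure Ω)} (hℳ : ℳ ⊆ caPos 𝔓) :
    IsSeqOrderClosed {Y : L0 𝔓 | 0 ≤ Y ∧ supIntegral ℳ Y ≤ 1} := by
  intro X X' hX h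
  have ht := h.ae_tendsto
  refine ⟨(L0.nonneg_iff _).2 ?_, iSup₂_le fun μ hμ => ?_⟩
  · filter_upwards [ht, ae_all_iff.2 fun n => (L0.nonneg_iff _).1 (hX n).1] with ω h1 h2
    exact ge_of_tendsto' h1 h2
  -- Fatou's lemma under each μ, using the quasi-sure convergence.
  · calc lintegralClass X' μ
        = ∫⁻ ω, liminf (fun n => ENNReal.ofReal (X n ω)) atTop ∂μ := by
          refine lintegral_congr_ae ?_
          filter_upwards [(hℳ hμ).2.ae_of_polar ht] with ω h1
          exact ((ENNReal.tendsto_ofReal h1).liminf_eq).symm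
      _ ≤ liminf (fun n => lintegralClass (X n) μ) atTop :=
          lintegral_liminf_le fun n => (X n).measurable.ennreal_ofReal
      _ ≤ liminf (fun _ : ℕ => (1 : ENNReal)) atTop :=
          liminf_le_liminf (Eventually.of_forall fun n =>
            (lintegralClass_le_supIntegral hμ (X n)).trans (hX n).2)
      _ = 1 := liminf_const _

/-- The image of a solid, sequentially order closed set under `j_Q` is closed under almost sure
convergence. -/
theorem exists_mem_ae_eq_of_ae_tendsto {C : Set (L0 𝔓)} (hsolid : IsSolidPos C)
    (hclosed : IsSeqOrderClosed C) (Q : Measure Ω) {Z : ℕ → L0 𝔓}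
    (hZ : ∀ n, Z n ∈ C) {g : Ω → ℝ} (hg : Measurable g)
    (hlim : ∀ᵐ ω ∂Q, Tendsto (fun n => Z n ω) atTop (𝓝 (g ω))) :
    ∃ Y ∈ C, ∃ A, MeasurableSet A ∧ (∀ᵐ ω ∂Q, ω ∈ A) ∧
      Y =ᵐ[polarMeasure 𝔓] A.indicator g := by
  -- Convergence may fail on an event that is Q-null but not polar. Cutting off outside A costs
  -- nothing under Q and makes the convergence below hold quasi surely.
  set A : Set Ω := {ω | Tendsto (fun n => Z n ω) atTop (𝓝 (g ω))} with hA
  have hAm : MeasurableSet A := by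
    have : A = {ω | Tendsto (fun n => Z n ω - g ω) atTop (𝓝 0)} := by
      ext ω
      simp only [hA, Set.mem_ofPred_eq]
      rw [← tendsto_sub_nhds_zero_iff]
    rw [this]
    exact measurableSet_tendsto (𝓝 0) fun n => (Z n).measurable.sub hg
  have hpos : ∀ᵐ ω ∂polarMeasure 𝔓, ∀ n, 0 ≤ Z n ω :=
    ae_all_iff.2 fun n => (L0.nonneg_iff _).1 (hsolid.1 _ (hZ n))
  -- Tail infima stay below Zₙ, hence in C by solidity, and increase to g on A; this turns pointwise
  -- convergence into order convergence.
  let f : ℕ → Ω → ℝ := fun n => A.indicator fun ω => ⨅ k, Z (n + k) ω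
  have hf : ∀ n, Measurable (f n) := fun n =>
    (Measurable.iInf fun k => (Z (n + k)).measurable).indicator hAm
  have hgA : Measurable (A.indicator g) := hg.indicator hAm
  refine ⟨L0.ofMeasurable 𝔓 _ hgA, ?_, A, hAm, hlim, L0.coeFn_ofMeasurable _ hgA⟩
  refine hclosed (fun n => L0.ofMeasurable 𝔓 (f n) (hf n)) _ (fun n => ?_)
    (orderTendsto_ofMeasurable_of_monotone hf hgA ?_ ?_)
  · refine hsolid.ofMeasurable_mem (hZ n) (hf n) ?_
    filter_upwards [hpos] with ω h
    have hb : BddBelow (Set.range fun k => Z (n + k) ω) :=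
      ⟨0, by rintro _ ⟨k, rfl⟩; exact h _⟩
    by_cases hω : ω ∈ A
    · simp only [f, Set.indicator_of_mem hω]
      exact ⟨le_ciInf fun k => h _, ciInf_le hb 0⟩
    · simp only [f, Set.indicator_of_notMem hω]
      exact ⟨le_rfl, h n⟩
  · filter_upwards [hpos] with ω h
    refine monotone_nat_of_le_succ fun n => ?_
    by_cases hω : ω ∈ A
    · simp only [f, Set.indicator_of_mem hω]
      refine le_ciInf fun k => ?_
      have := ciInf_le (f := fun k => Z (n + k) ω) ⟨0, by rintro _ ⟨k, rfl⟩; exact h _⟩ (1 + k)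
      rwa [← add_assoc] at this
    · simp only [f, Set.indicator_of_notMem hω, le_refl]
  · filter_upwards [hpos] with ω h
    by_cases hω : ω ∈ A
    · simp only [f, Set.indicator_of_mem hω]
      have hω' : Tendsto (fun n => Z n ω) atTop (𝓝 (g ω)) := hω
      rw [Metric.tendsto_atTop] at hω' ⊢
      intro ε hε
      obtain ⟨N, hN⟩ := hω' (ε / 2) (half_pos hε)
      refine ⟨N, fun n hn => ?_⟩
      have h1 : ⨅ k, Z (n + k) ω ≤ g ω + ε / 2 := by
        refine (ciInf_le ⟨0, by rintro _ ⟨k, rfl⟩; exact h _⟩ 0).trans ?_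
        have := hN (n + 0) (by omega)
        rw [Real.dist_eq, abs_lt] at this
        linarith
      have h2 : g ω - ε / 2 ≤ ⨅ k, Z (n + k) ω := by
        refine le_ciInf fun k => ?_
        have := hN (n + k) (by omega)
        rw [Real.dist_eq, abs_lt] at this
        linarith
      rw [Real.dist_eq, abs_lt]
      constructor <;> linarith
    · simp only [f, Set.indicator_of_notMem hω]
      exact tendsto_const_nhds

end General

end RobustTransport
namespace RobustTransport

open Filter Topology

/-! ### The bipolar theorem, by separation in L²(Q). -/

section Bipolar

variable {Ω : Type*} [MeasurableSpace Ω] {𝔓 : Set (Measure Ω)}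

theorem mem_Lp_two_of_bounded {Q : Measure Ω} [IsFiniteMeasure Q] {f : Ω → ℝ} (hf : Measurable f)
    {r : ℝ} (h : ∀ᵐ ω ∂Q, 0 ≤ f ω ∧ f ω ≤ r) : MemLp f 2 Q := by
  refine MemLp.of_bound hf.aestronglyMeasurable r ?_
  filter_upwards [h] with ω hω
  rw [Real.norm_eq_abs, abs_of_nonneg hω.1]
  exact hω.2

/-- The square integrable elements of the image of a solid, sequentially order closed set under
`j_Q` form a closed set. -/
theorem isClosed_setOf_Lp_two {C : Set (L0 𝔓)} (hsolid : IsSolidPos C)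
    (hclosed : IsSeqOrderClosed C) {Q : Measure Ω} (hQ : DominatedBy Q 𝔓) :
    IsClosed {f : Lp ℝ 2 Q | ∃ Y ∈ C, Y =ᵐ[Q] f} := by
  refine IsSeqClosed.isClosed fun u f hu hlim => ?_
  -- L²-convergence yields an almost surely convergent subsequence, to which closedness of C
  -- applies.
  obtain ⟨ns, -, hns⟩ := (tendstoInMeasure_of_tendsto_Lp hlim).exists_seq_tendsto_ae
  choose Z hZ e using hu
  have hg := (Lp.stronglyMeasurable f).measurable
  obtain ⟨Y, hY, A, -, hA, eY⟩ := exists_mem_ae_eq_of_ae_tendsto hsolid hclosed Q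
    (Z := fun n => Z (ns n)) (fun n => hZ _) hg (by
      filter_upwards [hns, ae_all_iff.2 e] with ω h1 h2
      simpa only [h2] using h1)
  refine ⟨Y, hY, ?_⟩
  filter_upwards [hQ.ae_of_polar eY, hA] with ω h1 h2
  rw [h1, Set.indicator_of_mem h2]

theorem convex_setOf_Lp_two {C : Set (L0 𝔓)} (hconv : Convex ℝ C) {Q : Measure Ω}
    (hQ : DominatedBy Q 𝔓) : Convex ℝ {f : Lp ℝ 2 Q | ∃ Y ∈ C, Y =ᵐ[Q] f} := by
  rintro f ⟨Y, hY, eY⟩ g ⟨Z, hZ, eZ⟩ a b ha hb hab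
  refine ⟨_, hconv hY hZ ha hb hab, ?_⟩
  filter_upwards [eY, eZ, hQ.ae_of_polar (AEEqFun.coeFn_add (a • Y) (b • Z)),
    hQ.ae_of_polar (AEEqFun.coeFn_smul a Y), hQ.ae_of_polar (AEEqFun.coeFn_smul b Z),
    Lp.coeFn_add (a • f) (b • g), Lp.coeFn_smul a f, Lp.coeFn_smul b g]
    with ω h1 h2 h3 h4 h5 h6 h7 h8
  rw [h3, h6, Pi.add_apply, Pi.add_apply, h4, h5, h7, h8, Pi.smul_apply, Pi.smul_apply,
    Pi.smul_apply, Pi.smul_apply, h1, h2]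

theorem tendsto_min_natCast (x : ℝ) : Tendsto (fun n : ℕ => min x n) atTop (𝓝 x) := by
  obtain ⟨N, hN⟩ := exists_nat_ge x
  refine tendsto_const_nhds.congr' ?_
  filter_upwards [eventually_ge_atTop N] with n hn
  exact (min_eq_left (hN.trans (Nat.cast_le.2 hn))).symm

/-- Truncations `X ∧ n` in the image of `C` under `j_Q` force `X` into that image. -/
theorem exists_ae_eq_of_truncations {C : Set (L0 𝔓)} (hsolid : IsSolidPos C)
    (hclosed : IsSeqOrderClosed C) {Q : Measure Ω} (hQ : DominatedBy Q 𝔓) (X : L0 𝔓)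
    (h : ∀ n : ℕ, ∃ Y ∈ C, ∀ᵐ ω ∂Q, Y ω = min (X ω) n) : ∃ Y ∈ C, Y =ᵐ[Q] X := by
  choose Z hZ e using h
  obtain ⟨Y, hY, A, -, hA, eY⟩ := exists_mem_ae_eq_of_ae_tendsto hsolid hclosed Q hZ X.measurable
    (by
      filter_upwards [ae_all_iff.2 e] with ω h2
      simpa only [h2] using tendsto_min_natCast (X ω))
  refine ⟨Y, hY, ?_⟩
  filter_upwards [hQ.ae_of_polar eY, hA] with ω h1 h2
  rw [h1, Set.indicator_of_mem h2]

/-- Separation in `L²(Q)`: a class outside the image of `C` under `j_Q` is separated from `C` by a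
`Q`-density. -/
theorem exists_density_of_not_mem_image {C : Set (L0 𝔓)} (hne : C.Nonempty) (hconv : Convex ℝ C)
    (hsolid : IsSolidPos C) (hclosed : IsSeqOrderClosed C) {Q : Measure Ω}
    (hQ : Q ∈ probDominated 𝔓) {X : L0 𝔓} (hX : 0 ≤ X) (hnot : ¬ ∃ Y ∈ C, Y =ᵐ[Q] X) :
    ∃ (g : Ω → ℝ) (u : ℝ), Measurable g ∧ Integrable g Q ∧ 0 < u ∧
      (∀ Y ∈ C, ∫⁻ ω, ENNReal.ofReal (g ω) * ENNReal.ofReal (Y ω) ∂Q ≤ ENNReal.ofReal u) ∧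
      ENNReal.ofReal u < ∫⁻ ω, ENNReal.ofReal (g ω) * ENNReal.ofReal (X ω) ∂Q := by
  have := hQ.1
  have hdom := hQ.2
  -- X need not be square integrable, so a truncation still outside the image is separated instead.
  obtain ⟨n, hn⟩ : ∃ n : ℕ, ¬ ∃ Y ∈ C, ∀ᵐ ω ∂Q, Y ω = min (X ω) n := by
    by_contra! hall
    exact hnot (exists_ae_eq_of_truncations hsolid hclosed hdom X hall)
  have hXpos := hdom.ae_of_polar ((L0.nonneg_iff X).1 hX)
  have hXn : MemLp (fun ω => min (X ω) n) 2 Q :=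
    mem_Lp_two_of_bounded (X.measurable.min measurable_const) (r := n) (by
      filter_upwards [hXpos] with ω h
      exact ⟨le_min h n.cast_nonneg, min_le_right _ _⟩)
  obtain ⟨φ, u, hφ, hu⟩ := geometric_hahn_banach_closed_point (convex_setOf_Lp_two hconv hdom)
    (isClosed_setOf_Lp_two hsolid hclosed hdom) (x := hXn.toLp _) (by
      rintro ⟨Y, hY, e⟩
      refine hn ⟨Y, hY, ?_⟩
      filter_upwards [e, hXn.coeFn_toLp] with ω h1 h2
      rw [h1, h2])
  -- The Riesz representative of the separating functional, possibly of variable sign.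
  set h : Lp ℝ 2 Q := (InnerProductSpace.toDual ℝ (Lp ℝ 2 Q)).symm φ with hh
  have hφh : ∀ f : Ω → ℝ, ∀ hf : MemLp f 2 Q, φ (hf.toLp f) = ∫ ω, h ω * f ω ∂Q := by
    intro f hf
    rw [← InnerProductSpace.toDual_symm_apply (𝕜 := ℝ) (y := φ), ← hh, L2.inner_def]
    refine integral_congr_ae ?_
    filter_upwards [hf.coeFn_toLp] with ω e
    simp [e, mul_comm]
  have hgm : Measurable h := (Lp.stronglyMeasurable h).measurable
  have hint : ∀ f : Ω → ℝ, MemLp f 2 Q → Integrable (fun ω => h ω * f ω) Q := fun f hf =>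
    (Lp.memLp h).integrable_mul hf
  -- The strict bound at 0 ∈ C makes u positive, so it can later be normalised to 1.
  have hupos : 0 < u := by
    have := hφ 0 ⟨0, hsolid.zero_mem hne, by
      filter_upwards [hdom.ae_of_polar (AEEqFun.coeFn_zero (μ := polarMeasure 𝔓) (β := ℝ)),
        Lp.coeFn_zero ℝ 2 Q] with ω h1 h2
      rw [h1, h2]⟩
    rwa [map_zero] at this
  refine ⟨h, u, hgm, (Lp.memLp h).integrable (by norm_num), hupos, fun Y hY => ?_, ?_⟩
  · have hYpos := (L0.nonneg_iff Y).1 (hsolid.1 Y hY)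
    have hbound : ∀ m : ℕ, ∫⁻ ω, ENNReal.ofReal (h ω) * ENNReal.ofReal (min (Y ω) m) ∂Q ≤
        ENNReal.ofReal u := by
      intro m
      -- Solidity keeps (Y ∧ m)·1_B in C, and testing h on it integrates the positive part of h
      -- against Y ∧ m. The truncation is removed by letting m → ∞.
      set B : Set Ω := {ω | 0 < h ω} with hB
      have hBm : MeasurableSet B := measurableSet_lt measurable_const hgm
      set f : Ω → ℝ := B.indicator fun ω => min (Y ω) m with hf
      have hfm : Measurable f := (Y.measurable.min measurable_const).indicator hBm
      have hf0 : ∀ᵐ ω ∂polarMeasure 𝔓, 0 ≤ f ω ∧ f ω ≤ min (Y ω) m := by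
        filter_upwards [hYpos] with ω h0
        have : 0 ≤ min (Y ω) (m : ℝ) := le_min h0 m.cast_nonneg
        by_cases hω : ω ∈ B
        · simp only [hf, Set.indicator_of_mem hω]; exact ⟨this, le_rfl⟩
        · simp only [hf, Set.indicator_of_notMem hω]; exact ⟨le_rfl, this⟩
      have hf2 : MemLp f 2 Q := mem_Lp_two_of_bounded hfm (r := m) (by
        filter_upwards [hdom.ae_of_polar hf0] with ω h1
        exact ⟨h1.1, h1.2.trans (min_le_right _ _)⟩)
      have hlt := hφ (hf2.toLp f) ⟨L0.ofMeasurable 𝔓 f hfm, hsolid.ofMeasurable_mem hY hfm (by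
        filter_upwards [hf0] with ω h1
        exact ⟨h1.1, h1.2.trans (min_le_left _ _)⟩), by
          filter_upwards [hdom.ae_of_polar (L0.coeFn_ofMeasurable f hfm), hf2.coeFn_toLp]
            with ω h1 h2
          rw [h1, h2]⟩
      rw [hφh] at hlt
      have hnn : 0 ≤ᵐ[Q] fun ω => h ω * f ω := by
        filter_upwards [hdom.ae_of_polar hf0] with ω h1
        by_cases hω : ω ∈ B
        · exact mul_nonneg (le_of_lt hω) h1.1
        · simp [hf, Set.indicator_of_notMem hω]
      calc ∫⁻ ω, ENNReal.ofReal (h ω) * ENNReal.ofReal (min (Y ω) m) ∂Q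
          = ∫⁻ ω, ENNReal.ofReal (h ω * f ω) ∂Q := by
            refine lintegral_congr fun ω => ?_
            by_cases hω : ω ∈ B
            · simp only [hf, Set.indicator_of_mem hω]
              rw [ENNReal.ofReal_mul (le_of_lt hω)]
            · have : h ω ≤ 0 := not_lt.1 hω
              simp [hf, Set.indicator_of_notMem hω, ENNReal.ofReal_of_nonpos this]
        _ = ENNReal.ofReal (∫ ω, h ω * f ω ∂Q) :=
            (ofReal_integral_eq_lintegral_ofReal (hint f hf2) hnn).symm
        _ ≤ ENNReal.ofReal u := ENNReal.ofReal_le_ofReal hlt.le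
    refine le_of_tendsto' (lintegral_tendsto_of_tendsto_of_monotone (fun m =>
      (hgm.ennreal_ofReal.mul (Y.measurable.min measurable_const).ennreal_ofReal).aemeasurable)
      ?_ ?_) hbound
    · refine ae_of_all _ fun ω i j hij => ?_
      have : min (Y ω) (i : ℝ) ≤ min (Y ω) (j : ℝ) := min_le_min_left _ (Nat.cast_le.2 hij)
      exact mul_le_mul_right (ENNReal.ofReal_le_ofReal this) _
    · refine ae_of_all _ fun ω => ?_
      exact ENNReal.Tendsto.const_mul (ENNReal.tendsto_ofReal (tendsto_min_natCast (Y ω)))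
        (Or.inr ENNReal.ofReal_ne_top)
  · rw [hφh] at hu
    have hi : 0 < ∫ ω, h ω * min (X ω) n ∂Q := hupos.trans hu
    -- Dropping the negative part of the integrand only increases the value on X, so the separation
    -- survives passing to the positive part of h.
    have hle : ENNReal.ofReal (∫ ω, h ω * min (X ω) n ∂Q) ≤
        ∫⁻ ω, ENNReal.ofReal (h ω * min (X ω) n) ∂Q := by
      rw [integral_eq_lintegral_pos_part_sub_lintegral_neg_part (hint _ hXn)]
      exact ENNReal.ofReal_le_of_le_toReal (sub_le_self _ ENNReal.toReal_nonneg)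
    refine (((ENNReal.ofReal_lt_ofReal_iff hi).2 hu).trans_le hle).trans_le
      (lintegral_mono_ae ?_)
    filter_upwards [hXpos] with ω h0
    rcases le_total 0 (h ω) with h1 | h1
    · rw [ENNReal.ofReal_mul h1]
      exact mul_le_mul_right (ENNReal.ofReal_le_ofReal (min_le_left _ _)) _
    · rw [ENNReal.ofReal_of_nonpos (mul_nonpos_of_nonpos_of_nonneg h1
        (le_min h0 n.cast_nonneg))]
      exact zero_le

/-- The bipolar theorem: convex, solid, sensitive and sequentially order closed sets contain their
bipolar. -/
theorem caBipolar_subset {C : Set (L0 𝔓)} (hne : C.Nonempty) (hconv : Convex ℝ C)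
    (hsolid : IsSolidPos C) (hsens : IsSensitive 𝔓 C) (hclosed : IsSeqOrderClosed C) :
    caBipolar 𝔓 C ⊆ C := by
  rintro X ⟨hX, hpol⟩
  refine (isSensitive_iff C).1 hsens X fun Q hQ => ?_
  by_contra hnot
  obtain ⟨g, u, hgm, hgi, hu, hC, hXu⟩ :=
    exists_density_of_not_mem_image hne hconv hsolid hclosed hQ hX hnot
  have := hQ.1
  have hu0 : ENNReal.ofReal u ≠ 0 := (ENNReal.ofReal_pos.2 hu).ne'
  -- Density g⁺/u: the separation threshold becomes the bound 1 of the polar.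
  set d : Ω → ENNReal := fun ω => (ENNReal.ofReal u)⁻¹ * ENNReal.ofReal (g ω) with hd
  have hdm : Measurable d := hgm.ennreal_ofReal.const_mul _
  have hval : ∀ Y : L0 𝔓, lintegralClass Y (Q.withDensity d) =
      (ENNReal.ofReal u)⁻¹ * ∫⁻ ω, ENNReal.ofReal (g ω) * ENNReal.ofReal (Y ω) ∂Q := by
    intro Y
    rw [lintegralClass, lintegral_withDensity_eq_lintegral_mul _ hdm Y.measurable.ennreal_ofReal,
      ← lintegral_const_mul' _ _ (ENNReal.inv_ne_top.2 hu0)]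
    simp only [hd, Pi.mul_apply, mul_assoc]
  have hfin : IsFiniteMeasure (Q.withDensity d) := by
    refine isFiniteMeasure_withDensity ?_
    rw [lintegral_const_mul _ hgm.ennreal_ofReal]
    exact ENNReal.mul_ne_top (ENNReal.inv_ne_top.2 hu0)
      (hgi.lintegral_lt_top).ne
  have hmem : Q.withDensity d ∈ caPolar 𝔓 C := by
    refine ⟨⟨hfin, fun N hN h0 => withDensity_absolutelyContinuous Q d (hQ.2 N hN h0)⟩,
      fun Y hY => ?_⟩
    rw [hval]
    calc _ ≤ (ENNReal.ofReal u)⁻¹ * ENNReal.ofReal u := by gcongr; exact hC Y hY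
      _ = 1 := ENNReal.inv_mul_cancel hu0 ENNReal.ofReal_ne_top
  have hle := hpol _ hmem
  rw [hval, mul_comm, ← div_eq_mul_inv, ENNReal.div_le_iff hu0 ENNReal.ofReal_ne_top,
    one_mul] at hle
  exact absurd hXu (not_lt.2 hle)

end Bipolar

/-! ### Transport duality: polars of 𝒞 and 𝒟, attainment. -/

section Duality

variable {Ω₁ Ω₂ : Type*} [MeasurableSpace Ω₁] [MeasurableSpace Ω₂]
  {𝔓₁ : Set (Measure Ω₁)} {𝔓₂ : Set (Measure Ω₂)}
  {ℳ₁ : Set (Measure Ω₁)} {ℳ₂ : Set (Measure Ω₂)}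

theorem DominatedBy.fst {μ : Measure (Ω₁ × Ω₂)} (hμ : DominatedBy μ (couplings 𝔓₁ 𝔓₂)) :
    DominatedBy μ.fst 𝔓₁ := by
  rw [dominatedBy_iff] at *
  exact (hμ.map measurable_fst).trans (quasiMeasurePreserving_fst 𝔓₁ 𝔓₂).absolutelyContinuous

theorem DominatedBy.snd {μ : Measure (Ω₁ × Ω₂)} (hμ : DominatedBy μ (couplings 𝔓₁ 𝔓₂)) :
    DominatedBy μ.snd 𝔓₂ := by
  rw [dominatedBy_iff] at *
  exact (hμ.map measurable_snd).trans (quasiMeasurePreserving_snd 𝔓₁ 𝔓₂).absolutelyContinuous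

theorem oplus_nonneg {X₁ : L0 𝔓₁} {X₂ : L0 𝔓₂} (h₁ : 0 ≤ X₁) (h₂ : 0 ≤ X₂) :
    0 ≤ oplus X₁ X₂ := by
  rw [L0.nonneg_iff] at *
  filter_upwards [oplus_ae X₁ X₂, (quasiMeasurePreserving_fst 𝔓₁ 𝔓₂).ae h₁,
    (quasiMeasurePreserving_snd 𝔓₁ 𝔓₂).ae h₂] with ω e a b
  rw [e]; exact add_nonneg a b

/-- Positivity matters: the integral sees positive parts only, and these are additive just for
nonnegative summands. -/
theorem lintegralClass_oplus {μ : Measure (Ω₁ × Ω₂)} (hμ : DominatedBy μ (couplings 𝔓₁ 𝔓₂))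
    {X₁ : L0 𝔓₁} {X₂ : L0 𝔓₂} (h₁ : 0 ≤ X₁) (h₂ : 0 ≤ X₂) :
    lintegralClass (oplus X₁ X₂) μ = lintegralClass X₁ μ.fst + lintegralClass X₂ μ.snd := by
  rw [lintegralClass_congr _ hμ (oplus_ae X₁ X₂), lintegralClass, lintegralClass, Measure.fst,
    Measure.snd, lintegral_map X₁.measurable.ennreal_ofReal measurable_fst,
    lintegral_map X₂.measurable.ennreal_ofReal measurable_snd,
    ← lintegral_add_left (f := fun ω : Ω₁ × Ω₂ => ENNReal.ofReal (X₁ ω.1))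
      (X₁.measurable.comp measurable_fst).ennreal_ofReal]
  refine lintegral_congr_ae ?_
  filter_upwards [hμ.ae_of_polar ((quasiMeasurePreserving_fst 𝔓₁ 𝔓₂).ae ((L0.nonneg_iff _).1 h₁)),
    hμ.ae_of_polar ((quasiMeasurePreserving_snd 𝔓₁ 𝔓₂).ae ((L0.nonneg_iff _).1 h₂))] with ω a b
  exact ENNReal.ofReal_add a b

theorem oplus_add (X₁ Y₁ : L0 𝔓₁) (X₂ Y₂ : L0 𝔓₂) :
    oplus (X₁ + Y₁) (X₂ + Y₂) = oplus X₁ X₂ + oplus Y₁ Y₂ := by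
  refine AEEqFun.ext ?_
  filter_upwards [oplus_ae (X₁ + Y₁) (X₂ + Y₂), AEEqFun.coeFn_add (oplus X₁ X₂) (oplus Y₁ Y₂),
    oplus_ae X₁ X₂, oplus_ae Y₁ Y₂,
    (quasiMeasurePreserving_fst 𝔓₁ 𝔓₂).ae (AEEqFun.coeFn_add X₁ Y₁),
    (quasiMeasurePreserving_snd 𝔓₁ 𝔓₂).ae (AEEqFun.coeFn_add X₂ Y₂)] with ω e1 e2 e3 e4 e5 e6
  rw [e1, e2, Pi.add_apply, e3, e4, e5, e6, Pi.add_apply, Pi.add_apply]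
  ring

theorem oplus_smul (a : ℝ) (X₁ : L0 𝔓₁) (X₂ : L0 𝔓₂) :
    oplus (a • X₁) (a • X₂) = a • oplus X₁ X₂ := by
  refine AEEqFun.ext ?_
  filter_upwards [oplus_ae (a • X₁) (a • X₂), AEEqFun.coeFn_smul a (oplus X₁ X₂), oplus_ae X₁ X₂,
    (quasiMeasurePreserving_fst 𝔓₁ 𝔓₂).ae (AEEqFun.coeFn_smul a X₁),
    (quasiMeasurePreserving_snd 𝔓₁ 𝔓₂).ae (AEEqFun.coeFn_smul a X₂)] with ω e1 e2 e3 e5 e6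
  rw [e1, e2, Pi.smul_apply, e3, e5, e6, Pi.smul_apply, Pi.smul_apply, smul_add]

theorem dualPairs_smul {a : ℝ} (ha : 0 ≤ a) {X : L0 (couplings 𝔓₁ 𝔓₂)} {p : L0 𝔓₁ × L0 𝔓₂}
    (hp : p ∈ dualPairs X) : a • p ∈ dualPairs (a • X) :=
  ⟨L0.smul_nonneg ha hp.1, L0.smul_nonneg ha hp.2.1, by
    rw [Prod.smul_fst, Prod.smul_snd, oplus_smul]; exact L0.smul_le_smul ha hp.2.2⟩

theorem dualPairs_add {X Y : L0 (couplings 𝔓₁ 𝔓₂)} {p q : L0 𝔓₁ × L0 𝔓₂}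
    (hp : p ∈ dualPairs X) (hq : q ∈ dualPairs Y) : p + q ∈ dualPairs (X + Y) :=
  ⟨by simpa using L0.add_le_add hp.1 hq.1, by simpa using L0.add_le_add hp.2.1 hq.2.1, by
    rw [Prod.fst_add, Prod.snd_add, oplus_add]; exact L0.add_le_add hp.2.2 hq.2.2⟩

theorem dualValue_smul (h₁ : ℳ₁ ⊆ caPos 𝔓₁) (h₂ : ℳ₂ ⊆ caPos 𝔓₂) {a : ℝ} (ha : 0 ≤ a)
    (p : L0 𝔓₁ × L0 𝔓₂) :
    dualValue ℳ₁ ℳ₂ (a • p) = ENNReal.ofReal a * dualValue ℳ₁ ℳ₂ p := by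
  rw [dualValue, dualValue, Prod.smul_fst, Prod.smul_snd, supIntegral_smul h₁ ha,
    supIntegral_smul h₂ ha, mul_add]

theorem dualValue_add_le (h₁ : ℳ₁ ⊆ caPos 𝔓₁) (h₂ : ℳ₂ ⊆ caPos 𝔓₂) (p q : L0 𝔓₁ × L0 𝔓₂) :
    dualValue ℳ₁ ℳ₂ (p + q) ≤ dualValue ℳ₁ ℳ₂ p + dualValue ℳ₁ ℳ₂ q := by
  refine (add_le_add (supIntegral_add_le h₁ p.1 q.1) (supIntegral_add_le h₂ p.2 q.2)).trans ?_
  rw [add_add_add_comm]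
  exact le_rfl

theorem primalMeasures_subset : primalMeasures 𝔓₁ 𝔓₂ ℳ₁ ℳ₂ ⊆ caPos (couplings 𝔓₁ 𝔓₂) :=
  fun _ h => h.1

/-- Weak duality. -/
theorem supIntegral_le_dualValue {X : L0 (couplings 𝔓₁ 𝔓₂)} {p : L0 𝔓₁ × L0 𝔓₂}
    (hp : p ∈ dualPairs X) :
    supIntegral (primalMeasures 𝔓₁ 𝔓₂ ℳ₁ ℳ₂) X ≤ dualValue ℳ₁ ℳ₂ p := by
  refine iSup₂_le fun μ hμ => ?_
  calc lintegralClass X μ ≤ lintegralClass (oplus p.1 p.2) μ := lintegralClass_mono hμ.1.2 hp.2.2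
    _ = lintegralClass p.1 μ.fst + lintegralClass p.2 μ.snd :=
        lintegralClass_oplus hμ.1.2 hp.1 hp.2.1
    _ ≤ dualValue ℳ₁ ℳ₂ p := add_le_add (lintegralClass_le_supIntegral hμ.2.1 _)
        (lintegralClass_le_supIntegral hμ.2.2 _)

theorem claimsC_subset_claimsD : claimsC 𝔓₁ 𝔓₂ ℳ₁ ℳ₂ ⊆ claimsD 𝔓₁ 𝔓₂ ℳ₁ ℳ₂ := by
  rintro Y ⟨hY, p, hp, hv⟩
  exact ⟨hY, (supIntegral_le_dualValue hp).trans hv⟩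

theorem zero_mem_claimsC (h₁ : ℳ₁ ⊆ caPos 𝔓₁) (h₂ : ℳ₂ ⊆ caPos 𝔓₂) :
    (0 : L0 (couplings 𝔓₁ 𝔓₂)) ∈ claimsC 𝔓₁ 𝔓₂ ℳ₁ ℳ₂ :=
  ⟨le_rfl, (0, 0), ⟨le_rfl, le_rfl, oplus_nonneg le_rfl le_rfl⟩, by
    simp [dualValue, supIntegral_zero h₁, supIntegral_zero h₂]⟩

theorem isSolidPos_claimsC : IsSolidPos (claimsC 𝔓₁ 𝔓₂ ℳ₁ ℳ₂) :=
  ⟨fun _ h => h.1, fun _ ⟨_, p, hp, hv⟩ _ hY hle =>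
    ⟨hY, p, ⟨hp.1, hp.2.1, hle.trans hp.2.2⟩, hv⟩⟩

theorem convex_claimsC (h₁ : ℳ₁ ⊆ caPos 𝔓₁) (h₂ : ℳ₂ ⊆ caPos 𝔓₂) :
    Convex ℝ (claimsC 𝔓₁ 𝔓₂ ℳ₁ ℳ₂) := by
  rintro X ⟨hX, p, hp, hpv⟩ Y ⟨hY, q, hq, hqv⟩ a b ha hb hab
  refine ⟨by simpa using L0.add_le_add (L0.smul_nonneg ha hX) (L0.smul_nonneg hb hY),
    a • p + b • q, dualPairs_add (dualPairs_smul ha hp) (dualPairs_smul hb hq), ?_⟩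
  calc dualValue ℳ₁ ℳ₂ (a • p + b • q)
      ≤ ENNReal.ofReal a * dualValue ℳ₁ ℳ₂ p + ENNReal.ofReal b * dualValue ℳ₁ ℳ₂ q := by
        rw [← dualValue_smul h₁ h₂ ha, ← dualValue_smul h₁ h₂ hb]
        exact dualValue_add_le h₁ h₂ _ _
    _ ≤ ENNReal.ofReal a * 1 + ENNReal.ofReal b * 1 := by gcongr
    _ = 1 := by rw [mul_one, mul_one, ← ENNReal.ofReal_add ha hb, hab, ENNReal.ofReal_one]

theorem primalMeasures_subset_caPolar_claimsD :
    primalMeasures 𝔓₁ 𝔓₂ ℳ₁ ℳ₂ ⊆ caPolar (couplings 𝔓₁ 𝔓₂) (claimsD 𝔓₁ 𝔓₂ ℳ₁ ℳ₂) :=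
  fun _ hμ => ⟨hμ.1, fun X hX => (lintegralClass_le_supIntegral hμ X).trans hX.2⟩

theorem supIntegral_caPolar_le {Ω : Type*} [MeasurableSpace Ω] {𝔓 : Set (Measure Ω)}
    {C : Set (L0 𝔓)} {X : L0 𝔓} (hX : X ∈ C) : supIntegral (caPolar 𝔓 C) X ≤ 1 :=
  iSup₂_le fun _ hμ => hμ.2 X hX

/-- Each X in C₁ has cost at most one against the polar of C₁, so X ⊕ 0 belongs to 𝒞, and its
integral under μ is that of X under the first marginal. The second marginal is symmetric. -/
theorem caPolar_claimsC_subset {C₁ : Set (L0 𝔓₁)} {C₂ : Set (L0 𝔓₂)} (hC₁ : ∀ X ∈ C₁, 0 ≤ X)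
    (hC₂ : ∀ X ∈ C₂, 0 ≤ X) :
    caPolar (couplings 𝔓₁ 𝔓₂) (claimsC 𝔓₁ 𝔓₂ (caPolar 𝔓₁ C₁) (caPolar 𝔓₂ C₂)) ⊆
      primalMeasures 𝔓₁ 𝔓₂ (caPolar 𝔓₁ C₁) (caPolar 𝔓₂ C₂) := by
  rintro μ ⟨hμ, hpol⟩
  have := hμ.1
  refine ⟨hμ, ⟨⟨inferInstance, hμ.2.fst⟩, fun X hX => ?_⟩, ⟨inferInstance, hμ.2.snd⟩,
    fun X hX => ?_⟩
  · have h0 := oplus_nonneg (𝔓₂ := 𝔓₂) (hC₁ X hX) le_rfl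
    have h := hpol (oplus X 0) ⟨h0, (X, 0), ⟨hC₁ X hX, le_rfl, le_rfl⟩, by
      rw [dualValue, supIntegral_zero fun _ h => h.1, add_zero]
      exact supIntegral_caPolar_le hX⟩
    rw [lintegralClass_oplus hμ.2 (hC₁ X hX) le_rfl] at h
    exact le_self_add.trans h
  · have h0 := oplus_nonneg (𝔓₁ := 𝔓₁) le_rfl (hC₂ X hX)
    have h := hpol (oplus 0 X) ⟨h0, (0, X), ⟨le_rfl, hC₂ X hX, le_rfl⟩, by
      rw [dualValue, supIntegral_zero fun _ h => h.1, zero_add]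
      exact supIntegral_caPolar_le hX⟩
    rw [lintegralClass_oplus hμ.2 le_rfl (hC₂ X hX)] at h
    exact le_add_self.trans h

theorem caBipolar_claimsD :
    caBipolar (couplings 𝔓₁ 𝔓₂) (claimsD 𝔓₁ 𝔓₂ ℳ₁ ℳ₂) = claimsD 𝔓₁ 𝔓₂ ℳ₁ ℳ₂ := by
  refine Set.Subset.antisymm (fun X hX => ⟨hX.1, iSup₂_le fun μ hμ => ?_⟩)
    fun X hX => ⟨hX.1, fun μ hμ => hμ.2 X hX⟩
  exact hX.2 μ (primalMeasures_subset_caPolar_claimsD hμ)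

theorem caBipolar_claimsC {C₁ : Set (L0 𝔓₁)} {C₂ : Set (L0 𝔓₂)} (hC₁ : ∀ X ∈ C₁, 0 ≤ X)
    (hC₂ : ∀ X ∈ C₂, 0 ≤ X) :
    caBipolar (couplings 𝔓₁ 𝔓₂) (claimsC 𝔓₁ 𝔓₂ (caPolar 𝔓₁ C₁) (caPolar 𝔓₂ C₂)) =
      caBipolar (couplings 𝔓₁ 𝔓₂) (claimsD 𝔓₁ 𝔓₂ (caPolar 𝔓₁ C₁) (caPolar 𝔓₂ C₂)) := by
  refine Set.Subset.antisymm (fun X hX => ⟨hX.1, fun μ hμ => ?_⟩)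
    fun X hX => ⟨hX.1, fun μ hμ => ?_⟩
  · exact hX.2 μ ⟨hμ.1, fun Y hY => hμ.2 Y (claimsC_subset_claimsD hY)⟩
  · exact hX.2 μ (primalMeasures_subset_caPolar_claimsD (caPolar_claimsC_subset hC₁ hC₂ hμ))

/-- Strong duality with dual attainment when `𝒞 = 𝒟`. -/
theorem isLeast_dualValue (h₁ : ℳ₁ ⊆ caPos 𝔓₁) (h₂ : ℳ₂ ⊆ caPos 𝔓₂)
    (hCD : claimsC 𝔓₁ 𝔓₂ ℳ₁ ℳ₂ = claimsD 𝔓₁ 𝔓₂ ℳ₁ ℳ₂) {X : L0 (couplings 𝔓₁ 𝔓₂)} (hX : 0 ≤ X)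
    (hpos : 0 < supIntegral (primalMeasures 𝔓₁ 𝔓₂ ℳ₁ ℳ₂) X)
    (hfin : supIntegral (primalMeasures 𝔓₁ 𝔓₂ ℳ₁ ℳ₂) X < ⊤) :
    IsLeast (dualValue ℳ₁ ℳ₂ '' dualPairs X)
      (supIntegral (primalMeasures 𝔓₁ 𝔓₂ ℳ₁ ℳ₂) X) := by
  set s := supIntegral (primalMeasures 𝔓₁ 𝔓₂ ℳ₁ ℳ₂) X with hs
  have hr : 0 < s.toReal := ENNReal.toReal_pos hpos.ne' hfin.ne
  have hof : ENNReal.ofReal s.toReal = s := ENNReal.ofReal_toReal hfin.ne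
  -- X/s has primal value exactly one, which is where 0 < s < ∞ enters.
  have hmem : s.toReal⁻¹ • X ∈ claimsC 𝔓₁ 𝔓₂ ℳ₁ ℳ₂ := by
    rw [hCD]
    refine ⟨L0.smul_nonneg (inv_nonneg.2 hr.le) hX, ?_⟩
    rw [supIntegral_smul primalMeasures_subset (inv_nonneg.2 hr.le), ENNReal.ofReal_inv_of_pos hr,
      hof, ← hs, ENNReal.inv_mul_cancel hpos.ne' hfin.ne]
  obtain ⟨-, p, hp, hv⟩ := hmem
  have hp' := dualPairs_smul hr.le hp
  rw [smul_inv_smul₀ hr.ne'] at hp'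
  refine ⟨⟨_, hp', le_antisymm ?_ (supIntegral_le_dualValue hp')⟩, ?_⟩
  · rw [dualValue_smul h₁ h₂ hr.le, hof]
    exact mul_le_of_le_one_right' hv
  · rintro _ ⟨q, hq, rfl⟩
    exact supIntegral_le_dualValue hq

end Duality

end RobustTransport

theorem mainTheorem10 {Ω₁ Ω₂ : Type*} [MeasurableSpace Ω₁] [MeasurableSpace Ω₂]
    -- the sets of probabilistic models for the two marginals
    (𝔓₁ : Set (Measure Ω₁)) (𝔓₂ : Set (Measure Ω₂))
    (hne₁ : 𝔓₁.Nonempty) (hne₂ : 𝔓₂.Nonempty)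
    (hprob₁ : ∀ P ∈ 𝔓₁, IsProbabilityMeasure P) (hprob₂ : ∀ P ∈ 𝔓₂, IsProbabilityMeasure P)
    -- the sets `ℳᵢ` are polars of sets `Cᵢ` in the positive cones
    (C₁ : Set (L0 𝔓₁)) (C₂ : Set (L0 𝔓₂))
    (hCne₁ : C₁.Nonempty) (hCconv₁ : Convex ℝ C₁) (hCsolid₁ : IsSolidPos C₁)
    (hCsens₁ : IsSensitive 𝔓₁ C₁) (hCclosed₁ : IsSeqOrderClosed C₁)
    (hCne₂ : C₂.Nonempty) (hCconv₂ : Convex ℝ C₂) (hCsolid₂ : IsSolidPos C₂)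
    (hCsens₂ : IsSensitive 𝔓₂ C₂) (hCclosed₂ : IsSeqOrderClosed C₂)
    (ℳ₁ : Set (Measure Ω₁)) (ℳ₂ : Set (Measure Ω₂))
    (hℳ₁ : ℳ₁ = caPolar 𝔓₁ C₁) (hℳ₂ : ℳ₂ = caPolar 𝔓₂ C₂) :
    caBipolar (couplings 𝔓₁ 𝔓₂) (claimsC 𝔓₁ 𝔓₂ ℳ₁ ℳ₂) =
        caBipolar (couplings 𝔓₁ 𝔓₂) (claimsD 𝔓₁ 𝔓₂ ℳ₁ ℳ₂) ∧
    caBipolar (couplings 𝔓₁ 𝔓₂) (claimsD 𝔓₁ 𝔓₂ ℳ₁ ℳ₂) = claimsD 𝔓₁ 𝔓₂ ℳ₁ ℳ₂ ∧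
    (claimsC 𝔓₁ 𝔓₂ ℳ₁ ℳ₂ = claimsD 𝔓₁ 𝔓₂ ℳ₁ ℳ₂ ↔
      IsSensitive (couplings 𝔓₁ 𝔓₂) (claimsC 𝔓₁ 𝔓₂ ℳ₁ ℳ₂) ∧
        IsSeqOrderClosed (claimsC 𝔓₁ 𝔓₂ ℳ₁ ℳ₂)) ∧
    -- `𝒞 = 𝒟` entails absence of a duality gap and dual attainment
    (claimsC 𝔓₁ 𝔓₂ ℳ₁ ℳ₂ = claimsD 𝔓₁ 𝔓₂ ℳ₁ ℳ₂ →
      ∀ X : L0 (couplings 𝔓₁ 𝔓₂), 0 ≤ X →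
        0 < supIntegral (primalMeasures 𝔓₁ 𝔓₂ ℳ₁ ℳ₂) X →
        supIntegral (primalMeasures 𝔓₁ 𝔓₂ ℳ₁ ℳ₂) X < ⊤ →
        IsLeast (dualValue ℳ₁ ℳ₂ '' dualPairs X)
          (supIntegral (primalMeasures 𝔓₁ 𝔓₂ ℳ₁ ℳ₂) X)) := by
  subst hℳ₁ hℳ₂
  have h₁ : caPolar 𝔓₁ C₁ ⊆ caPos 𝔓₁ := fun _ h => h.1
  have h₂ : caPolar 𝔓₂ C₂ ⊆ caPos 𝔓₂ := fun _ h => h.1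
  have hC := caBipolar_claimsC hCsolid₁.1 hCsolid₂.1
  refine ⟨hC, caBipolar_claimsD, ⟨fun h => ?_, fun h => ?_⟩,
    fun h X hX hpos hfin => isLeast_dualValue h₁ h₂ h hX hpos hfin⟩
  · rw [h]
    exact ⟨isSensitive_setOf_supIntegral_le (fun P hP => hP.1) primalMeasures_subset,
      isSeqOrderClosed_setOf_supIntegral_le primalMeasures_subset⟩
  -- Since 𝒟 = 𝒞°°, the missing inclusion is the bipolar theorem for 𝒞.
  · refine Set.Subset.antisymm claimsC_subset_claimsD ?_
    rw [← caBipolar_claimsD, ← hC]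
    exact caBipolar_subset ⟨0, zero_mem_claimsC h₁ h₂⟩ (convex_claimsC h₁ h₂) isSolidPos_claimsC
      h.1 h.2
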